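/- Let $n\in\mathbb N$, $H=\mathbb C^n$ and $B(H)=M_n(\mathbb C)$. On $B(H)\otimes B(H)\cong M_{n^2}(\mathbb C)$ let $$\pi(a)=\inf\Big\{\sum_{i=1}^m\|x_i\|\,\|y_i\|_1:\ a=\sum_{i=1}^m x_i\otimes y_i\Big\}$$ be the projective norm, where $\|\cdot\|$ is the operator norm and $\|\cdot\|_1$ the trace norm, and let $$\alpha(\varrho)=\sup_{a\neq 0}\frac{|\operatorname{Tr}(\varrho a)|}{\pi(a)}$$ be its dual norm. Call $\varrho$ block-positive if $(f\otimes g,\varrho\, f\otimes g)\ge 0$ for all $f,g\in H$. Let $X$ be either the whole space $(B(H)\otimes B(H),\alpha)$, regarded as a real Banach space, or its real subspace of self-adjoint elements. Put $$\mathfrak B_1=\{\sigma\in X:\alpha(\sigma)\le 1\},\qquad \mathfrak B_1^{(+)}=\{\sigma\in\mathfrak B_1:\sigma=\sigma^*,\ \sigma\text{ block-positive}\}.$$ A point $x$ of a convex set $C\subseteq X$ is an exposed point of $C$ if some continuous real-linear functional on $X$ attains its maximum over $C$ at $x$ and only at $x$. For a real Banach space $Z$ with unit sphere $S_Z$, a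 point $x\in S_Z$ is called: *rotund* if $y\in S_Z$ and $\|\frac{x+y}2\|=1$ imply $x=y$; *smooth* if there is exactly one $f\in S_{Z^*}$ with $f(x)=1$; *strongly non-smooth* if, for every $y\in S_Z\setminus\{x\}$ with $[x,y]\subseteq S_Z$, the point $x$ is not a smooth point of the subspace $\operatorname{span}_{\mathbb R}\{x,y\}$ with the inherited norm. **Theorem.** For both choices of $X$: 1. Every exposed point $\sigma$ of $\mathfrak B_1^{(+)}$ with $\operatorname{Tr}\sigma=n$ is also an exposed point of $\mathfrak B_1$. 2. Conversely, if $\varrho\in\mathfrak B_1$ is block-positive, strongly non-smooth (as a point of $X$) and not rotund (as a point of $X$), then $\varrho$ is an exposed point of $\mathfrak B_1^{(+)}$. -/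

import Mathlib

open Matrix Kronecker
open scoped ComplexOrder

/-! ### Special points of the unit ball of a real normed space -/

section Convexity

variable {E : Type*} [NormedAddCommGroup E] [NormedSpace ℝ E]

/-- `x` is a rotund point of the unit ball of `E`. -/
def IsRotundPoint (x : E) : Prop :=
  ‖x‖ = 1 ∧ ∀ y : E, ‖y‖ = 1 → ‖(1 / 2 : ℝ) • (x + y)‖ = 1 → x = y

/-- `x` is a smooth point of the unit ball of `E`: it lies on the unit sphere and there is exactly
one functional of norm one which takes the value `1` at `x`. -/
def IsSmoothPoint (x : E) : Prop :=
  ‖x‖ = 1 ∧ ∃! f : StrongDual ℝ E, ‖f‖ = 1 ∧ f x = 1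

/-- `x` is a strongly non-smooth point of the unit ball of `E`: it lies on the unit sphere and, for
every other point `y` of the sphere such that the segment `[x, y]` is contained in the sphere, `x`
is not a smooth point of the unit ball of `span {x, y}` (with the norm inherited from `E`). -/
def IsStronglyNonSmoothPoint (x : E) : Prop :=
  ‖x‖ = 1 ∧ ∀ y : E, ‖y‖ = 1 → y ≠ x → segment ℝ x y ⊆ Metric.sphere (0 : E) 1 →
    ¬ IsSmoothPoint
      (⟨x, Submodule.subset_span (Set.mem_insert x {y})⟩ : Submodule.span ℝ ({x, y} : Set E))

end Convexity

/-! ### The projective norm `π` and its dual norm `α` -/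

/-- The trace norm of a square matrix: the sum of its singular values. -/
noncomputable def traceNorm {n : ℕ} (b : Matrix (Fin n) (Fin n) ℂ) : ℝ :=
  ∑ i, √((isHermitian_conjTranspose_mul_self b).eigenvalues i)

/-- The operator norm of a square matrix acting on the Hilbert space `ℂⁿ`. -/
noncomputable def operatorNorm {n : ℕ} (a : Matrix (Fin n) (Fin n) ℂ) : ℝ :=
  ‖toEuclideanCLM (n := Fin n) (𝕜 := ℂ) a‖

/-- The values `∑ ‖x i‖ ‖y i‖₁` over all representations `a = ∑ x i ⊗ y i`. -/
def projectiveCosts {n : ℕ} (a : Matrix (Fin n × Fin n) (Fin n × Fin n) ℂ) : Set ℝ :=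
  {r | ∃ (m : ℕ) (x y : Fin m → Matrix (Fin n) (Fin n) ℂ),
    a = ∑ i, x i ⊗ₖ y i ∧ r = ∑ i, operatorNorm (x i) * traceNorm (y i)}

/-- The projective norm `π`, where the first factor carries the operator norm and the second one
the trace norm. -/
noncomputable def projectiveNorm {n : ℕ} (a : Matrix (Fin n × Fin n) (Fin n × Fin n) ℂ) : ℝ :=
  sInf (projectiveCosts a)

/-- The norm `α`, dual to the projective norm under the pairing `(ρ, a) ↦ Tr (ρ a)`. -/
noncomputable def alphaNorm {n : ℕ} (ρ : Matrix (Fin n × Fin n) (Fin n × Fin n) ℂ) : ℝ :=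
  ⨆ a : {a : Matrix (Fin n × Fin n) (Fin n × Fin n) ℂ // a ≠ 0},
    ‖(ρ * a.1).trace‖ / projectiveNorm a.1

/-! The function `alphaNorm` is indeed a norm. -/

theorem traceNorm_nonneg {n : ℕ} (b : Matrix (Fin n) (Fin n) ℂ) : 0 ≤ traceNorm b :=
  Finset.sum_nonneg fun _ _ => Real.sqrt_nonneg _

theorem operatorNorm_nonneg {n : ℕ} (b : Matrix (Fin n) (Fin n) ℂ) : 0 ≤ operatorNorm b :=
  norm_nonneg _

theorem norm_entry_le_operatorNorm {n : ℕ} (a : Matrix (Fin n) (Fin n) ℂ) (i j : Fin n) :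
    ‖a i j‖ ≤ operatorNorm a := by
  have h := (toEuclideanCLM (n := Fin n) (𝕜 := ℂ) a).le_opNorm (EuclideanSpace.single j 1)
  have h2 := PiLp.norm_apply_le
    ((toEuclideanCLM (n := Fin n) (𝕜 := ℂ) a) (EuclideanSpace.single j 1)) i
  have h3 : ((toEuclideanCLM (n := Fin n) (𝕜 := ℂ) a) (EuclideanSpace.single j 1)) i = a i j := by
    rw [← congrFun (ofLp_toEuclideanCLM a (EuclideanSpace.single j 1)) i |>.symm]
    simp
  rw [h3] at h2
  refine h2.trans (h.trans ?_)
  simp [operatorNorm]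

theorem norm_entry_le_traceNorm {n : ℕ} (b : Matrix (Fin n) (Fin n) ℂ) (i j : Fin n) :
    ‖b i j‖ ≤ traceNorm b := by
  have hpos : ∀ k, 0 ≤ (isHermitian_conjTranspose_mul_self b).eigenvalues k :=
    (posSemidef_conjTranspose_mul_self b).eigenvalues_nonneg
  have h1 : ∑ k, (isHermitian_conjTranspose_mul_self b).eigenvalues k ≤ traceNorm b ^ 2 := by
    have := Finset.sum_sq_le_sq_sum_of_nonneg (s := Finset.univ)
      (f := fun k => √((isHermitian_conjTranspose_mul_self b).eigenvalues k))
      (fun k _ => Real.sqrt_nonneg _)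
    simp only [Real.sq_sqrt (hpos _)] at this
    exact this
  have h2 : ∑ k, (isHermitian_conjTranspose_mul_self b).eigenvalues k
      = ∑ l, ∑ k, ‖b k l‖ ^ 2 := by
    have h := (isHermitian_conjTranspose_mul_self b).trace_eq_sum_eigenvalues
    have h' : (bᴴ * b).trace = ((∑ l, ∑ k, ‖b k l‖ ^ 2 : ℝ) : ℂ) := by
      simp [Matrix.trace, Matrix.mul_apply, Complex.conj_mul']
    rw [h'] at h
    apply Complex.ofReal_injective
    rw [h]
    simp
  have h3 : ‖b i j‖ ^ 2 ≤ ∑ l, ∑ k, ‖b k l‖ ^ 2 :=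
    (Finset.single_le_sum (f := fun k => ‖b k j‖ ^ 2) (fun _ _ => by positivity)
      (Finset.mem_univ i)).trans
    (Finset.single_le_sum (f := fun l => ∑ k, ‖b k l‖ ^ 2)
      (fun _ _ => Finset.sum_nonneg fun _ _ => by positivity) (Finset.mem_univ j))
  exact le_of_sq_le_sq (by linarith) (traceNorm_nonneg b)

theorem projectiveCosts_nonempty {n : ℕ} (a : Matrix (Fin n × Fin n) (Fin n × Fin n) ℂ) :
    (projectiveCosts a).Nonempty := by
  let e := Fintype.equivFin ((Fin n × Fin n) × (Fin n × Fin n))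
  refine ⟨_, _, fun k => single (e.symm k).1.1 (e.symm k).2.1 (a (e.symm k).1 (e.symm k).2),
    fun k => single (e.symm k).1.2 (e.symm k).2.2 1, ?_, rfl⟩
  rw [e.symm.sum_comp (fun k => single k.1.1 k.2.1 (a k.1 k.2) ⊗ₖ single k.1.2 k.2.2 (1 : ℂ))]
  rw [Fintype.sum_prod_type]
  conv_lhs => rw [matrix_eq_sum_single a]
  simp [single_kronecker_single]

theorem projectiveNorm_nonneg {n : ℕ} (a : Matrix (Fin n × Fin n) (Fin n × Fin n) ℂ) :
    0 ≤ projectiveNorm a := by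
  apply Real.sInf_nonneg
  rintro _ ⟨m, x, y, -, rfl⟩
  exact Finset.sum_nonneg fun i _ => mul_nonneg (operatorNorm_nonneg _) (traceNorm_nonneg _)

theorem norm_trace_mul_le {n : ℕ} (ρ a : Matrix (Fin n × Fin n) (Fin n × Fin n) ℂ) :
    ‖(ρ * a).trace‖ ≤ (∑ p, ∑ q, ‖ρ p q‖) * projectiveNorm a := by
  have hC : 0 ≤ ∑ p, ∑ q, ‖ρ p q‖ :=
    Finset.sum_nonneg fun _ _ => Finset.sum_nonneg fun _ _ => norm_nonneg _
  have key : ∀ r ∈ projectiveCosts a, ‖(ρ * a).trace‖ ≤ (∑ p, ∑ q, ‖ρ p q‖) * r := by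
    rintro _ ⟨m, x, y, rfl, rfl⟩
    rw [Finset.mul_sum, trace_sum, Finset.mul_sum]
    refine (norm_sum_le _ _).trans (Finset.sum_le_sum fun i _ => ?_)
    simp only [Matrix.trace, Matrix.diag_apply, Matrix.mul_apply]
    rw [Finset.sum_mul]
    refine (norm_sum_le _ _).trans (Finset.sum_le_sum fun p _ => ?_)
    rw [Finset.sum_mul]
    refine (norm_sum_le _ _).trans (Finset.sum_le_sum fun q _ => ?_)
    rw [norm_mul, kroneckerMap_apply, norm_mul]
    gcongr
    · exact operatorNorm_nonneg _
    · exact norm_entry_le_operatorNorm _ _ _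
    · exact norm_entry_le_traceNorm _ _ _
  rcases hC.eq_or_lt with h0 | h0
  · obtain ⟨r, hr⟩ := projectiveCosts_nonempty a
    have := key r hr
    rw [← h0] at this ⊢
    simpa using this
  · rw [← div_le_iff₀' h0]
    exact le_csInf (projectiveCosts_nonempty a) fun r hr => by
      rw [div_le_iff₀' h0]; exact key r hr

theorem projectiveNorm_pos {n : ℕ} {a : Matrix (Fin n × Fin n) (Fin n × Fin n) ℂ} (ha : a ≠ 0) :
    0 < projectiveNorm a := by
  refine (projectiveNorm_nonneg a).lt_of_ne fun h => ha ?_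
  rw [ext_iff_trace_mul_left]
  intro ρ
  have := norm_trace_mul_le ρ a
  rw [← h, mul_zero] at this
  simpa using this

theorem alphaNorm_bddAbove {n : ℕ} (ρ : Matrix (Fin n × Fin n) (Fin n × Fin n) ℂ) :
    BddAbove (Set.range fun a : {a : Matrix (Fin n × Fin n) (Fin n × Fin n) ℂ // a ≠ 0} =>
      ‖(ρ * a.1).trace‖ / projectiveNorm a.1) := by
  refine ⟨∑ p, ∑ q, ‖ρ p q‖, ?_⟩
  rintro _ ⟨a, rfl⟩
  exact (div_le_iff₀ (projectiveNorm_pos a.2)).2 (norm_trace_mul_le ρ a.1)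

theorem alphaNorm_nonneg {n : ℕ} (ρ : Matrix (Fin n × Fin n) (Fin n × Fin n) ℂ) :
    0 ≤ alphaNorm ρ :=
  Real.iSup_nonneg fun _ => div_nonneg (norm_nonneg _) (projectiveNorm_nonneg _)

theorem norm_trace_mul_le_alphaNorm {n : ℕ}
    (ρ a : Matrix (Fin n × Fin n) (Fin n × Fin n) ℂ) :
    ‖(ρ * a).trace‖ ≤ alphaNorm ρ * projectiveNorm a := by
  by_cases ha : a = 0
  · subst ha
    simpa using mul_nonneg (alphaNorm_nonneg ρ) (projectiveNorm_nonneg 0)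
  · rw [← div_le_iff₀ (projectiveNorm_pos ha)]
    exact le_ciSup (alphaNorm_bddAbove ρ) ⟨a, ha⟩

/-! ### The Banach space `B(H) ⊗_α B(H)` for `H = ℂⁿ` -/

/-- The space `B(H) ⊗ B(H)`, `H = ℂⁿ`, of matrices indexed by pairs, to be equipped with the
norm `α`. -/
def AlphaSpace (n : ℕ) : Type := Matrix (Fin n × Fin n) (Fin n × Fin n) ℂ

namespace AlphaSpace

variable {n : ℕ}

instance : AddCommGroup (AlphaSpace n) :=
  inferInstanceAs (AddCommGroup (Matrix (Fin n × Fin n) (Fin n × Fin n) ℂ))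

instance : Module ℂ (AlphaSpace n) :=
  inferInstanceAs (Module ℂ (Matrix (Fin n × Fin n) (Fin n × Fin n) ℂ))

/-- The underlying matrix. -/
def toMatrix : AlphaSpace n ≃ₗ[ℂ] Matrix (Fin n × Fin n) (Fin n × Fin n) ℂ :=
  LinearEquiv.refl ℂ (Matrix (Fin n × Fin n) (Fin n × Fin n) ℂ)

noncomputable instance : Norm (AlphaSpace n) := ⟨fun ρ => alphaNorm (toMatrix ρ)⟩

theorem norm_def (ρ : AlphaSpace n) : ‖ρ‖ = alphaNorm (toMatrix ρ) := rfl

theorem normCore : NormedSpace.Core ℂ (AlphaSpace n) where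
  norm_nonneg ρ := alphaNorm_nonneg _
  norm_smul c ρ := by
    simp only [norm_def, map_smul, alphaNorm, Matrix.smul_mul, trace_smul, norm_smul, mul_div_assoc]
    rw [Real.mul_iSup_of_nonneg (norm_nonneg c)]
  norm_triangle ρ σ := by
    simp only [norm_def]
    refine Real.iSup_le (fun a => ?_) (add_nonneg (alphaNorm_nonneg _) (alphaNorm_nonneg _))
    rw [div_le_iff₀ (projectiveNorm_pos a.2), map_add, add_mul, trace_add, add_mul]
    exact (norm_add_le _ _).trans
      (add_le_add (norm_trace_mul_le_alphaNorm _ _) (norm_trace_mul_le_alphaNorm _ _))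
  norm_eq_zero_iff ρ := by
    constructor
    · intro h
      rw [norm_def] at h
      rw [← map_eq_zero_iff _ toMatrix.injective, ext_iff_trace_mul_right]
      intro a
      have := norm_trace_mul_le_alphaNorm (toMatrix ρ) a
      rw [h, zero_mul] at this
      simpa using this
    · rintro rfl
      simp [norm_def, alphaNorm]

noncomputable instance : NormedAddCommGroup (AlphaSpace n) := NormedAddCommGroup.ofCore normCore

noncomputable instance : NormedSpace ℂ (AlphaSpace n) := NormedSpace.ofCore normCore

/-- Block positivity: `(f ⊗ g, ρ (f ⊗ g)) ≥ 0` for all vectors `f`, `g`. -/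
def BlockPositive (ρ : AlphaSpace n) : Prop :=
  ∀ f g : Fin n → ℂ,
    0 ≤ star (fun p : Fin n × Fin n => f p.1 * g p.2) ⬝ᵥ
      (toMatrix ρ *ᵥ fun p : Fin n × Fin n => f p.1 * g p.2)

/-- The real linear subspace of self-adjoint elements. -/
def hermitianPart (n : ℕ) : Submodule ℝ (AlphaSpace n) where
  carrier := {ρ | (toMatrix ρ).IsHermitian}
  add_mem' ha hb := by
    rw [Set.mem_ofPred_eq, map_add]
    exact ha.add hb
  zero_mem' := by
    rw [Set.mem_ofPred_eq, map_zero]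
    exact isHermitian_zero
  smul_mem' c ρ h := by
    have h' : (toMatrix ρ)ᴴ = toMatrix ρ := h
    have hc : toMatrix (c • ρ) = (c : ℂ) • toMatrix ρ := rfl
    rw [Set.mem_ofPred_eq, hc, Matrix.IsHermitian, conjTranspose_smul, h']
    simp

/-- The unit ball `𝔅₁` of a real subspace `X` of `B(H) ⊗_α B(H)`. -/
def unitBall (X : Submodule ℝ (AlphaSpace n)) : Set X :=
  {σ | ‖σ‖ ≤ 1}

/-- The set `𝔅₁⁽⁺⁾` of self-adjoint block positive elements of the unit ball of `X`. -/
def positiveUnitBall (X : Submodule ℝ (AlphaSpace n)) : Set X :=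
  {σ | ‖σ‖ ≤ 1 ∧ (toMatrix (σ : AlphaSpace n)).IsHermitian ∧ BlockPositive (σ : AlphaSpace n)}

end AlphaSpace

/-!
An element `ρ` of the unit ball corresponds to a contraction `S` of `B(H)` by
`Tr (S(x) y) = Tr (ρ (x ⊗ y))`; block positivity of `ρ` is positivity of `S`, the matrix
`partialTrace ρ` is `S(1)`, and `Tr ρ = Tr S(1)`.

*From the block positive part to the whole ball.* Testing a contraction on the unitaries
`1 + (z - 1) f f*` with `|z| = 1` gives, for unit vectors `f` and `g`,
`|a - s| + |s| ≤ 1` with `a = ⟨g, S(1) g⟩` and `s = ⟨f ⊗ g, ρ (f ⊗ g)⟩`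
(`norm_form_sub_add_norm_form_le`). This has two consequences. If `Re Tr ρ = n`, then `S(1) = 1`, so
`a = 1`, hence `s ≥ 0` and `ρ` is block positive (`AlphaSpace.blockPositive_of_re_trace_eq`). If `ρ`
is merely hermitian, then `s ≥ -(1 - a) / 2`, so `ρ + (1 / 2) 1 ⊗ (1 - S(1))` is block positive
(`AlphaSpace.blockPositive_add_correction`). As `1 - S(1)` is positive semidefinite, this correction
has norm at most a constant times its trace, that is, it is *linear* in the defect
`δ = n - Re Tr ρ`. Therefore a functional `φ` which exposes `σ` in the block positive part of the ball
satisfies `φ (Re ρ) ≤ φ σ + O(δ)` on the whole ball, where `Re ρ` is the hermitian part, and for large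
`K` the functional `φ ∘ Re + K Re Tr` is maximal only where `δ = 0`. There all elements are block
positive, and `φ` singles out `σ`.

*Strongly non-smooth points.* In finite dimensions, let `l` be the sum of finitely many norming
functionals of `x` which span all of them. If `l` is maximal over the ball at some `y ≠ x` too, then all
norming functionals of `x` are `1` at `y`, so `[x, y]` lies on the sphere and, by Hahn-Banach, `x` is
smooth in `span {x, y}`. So a strongly non-smooth point is exposed in the ball
(`IsStronglyNonSmoothPoint.mem_exposedPoints_closedBall`), and all the more in each part of the ball
that contains it.
-/

/-! ### Strongly non-smooth points are exposed -/

/-- A strongly non-smooth point of a finite-dimensional unit ball is exposed. The exposing functional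
is the sum of finitely many norming functionals of `x` which span all of them: where it is maximal,
every norming functional takes the value `1`, and a point `y ≠ x` with this property would make `x`
smooth in `span {x, y}`. -/
theorem IsStronglyNonSmoothPoint.mem_exposedPoints_closedBall {E : Type*} [NormedAddCommGroup E]
    [NormedSpace ℝ E] [FiniteDimensional ℝ E] {x : E} (hx : IsStronglyNonSmoothPoint x) :
    x ∈ (Metric.closedBall (0 : E) 1).exposedPoints ℝ := by
  obtain ⟨hx1, hns⟩ := hx
  set J : Set (StrongDual ℝ E) := {f | ‖f‖ = 1 ∧ f x = 1} with hJ
  obtain ⟨b, hbJ, hspan, hli⟩ := exists_linearIndependent ℝ J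
  have hbfin : b.Finite := hli.setFinite
  set l : StrongDual ℝ E := ∑ g ∈ hbfin.toFinset, g with hl
  have hle : ∀ g ∈ J, ∀ y ∈ Metric.closedBall (0 : E) 1, g y ≤ 1 := by
    intro g hg y hy
    have := g.le_opNorm y
    rw [hg.1, one_mul] at this
    exact (le_abs_self _).trans (this.trans (by simpa using hy))
  have hlx : l x = ∑ g ∈ hbfin.toFinset, (1 : ℝ) := by
    rw [hl, _root_.sum_apply]
    exact Finset.sum_congr rfl fun g hg => (hbJ (hbfin.mem_toFinset.1 hg)).2
  refine ⟨by simp [hx1], l, fun y hy => ⟨?_, fun hxy => ?_⟩⟩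
  · rw [hlx, hl, _root_.sum_apply]
    exact Finset.sum_le_sum fun g hg => hle g (hbJ (hbfin.mem_toFinset.1 hg)) y hy
  have hb1 : ∀ g ∈ b, g y = 1 := by
    rw [hlx, hl, _root_.sum_apply] at hxy
    have hterm : ∀ g ∈ hbfin.toFinset, g y ≤ 1 := fun g hg =>
      hle g (hbJ (hbfin.mem_toFinset.1 hg)) y hy
    have := (Finset.sum_eq_sum_iff_of_le hterm).1 ((Finset.sum_le_sum hterm).antisymm hxy)
    exact fun g hg => this g (hbfin.mem_toFinset.2 hg)
  have hJy : ∀ g ∈ J, g y = 1 := by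
    intro g hg
    have hmem : g ∈ Submodule.span ℝ b := hspan ▸ Submodule.subset_span hg
    have : g y = g x := by
      clear hg
      induction hmem using Submodule.span_induction with
      | mem g hg => rw [hb1 g hg, (hbJ hg).2]
      | zero => simp
      | add g h _ _ hg hh => simp [hg, hh]
      | smul c g _ hg => simp [hg]
    rw [this, hg.2]
  -- Any norming functional of `x` shows that `[x, y]` lies on the sphere.
  have hx0 : x ≠ 0 := fun h => by simp [h] at hx1
  obtain ⟨g₀, hg₀, hg₀x⟩ := exists_dual_vector ℝ x (norm_ne_zero_iff.2 hx0)
  have hg₀J : g₀ ∈ J := ⟨hg₀, by simpa [hx1] using hg₀x⟩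
  have hseg : segment ℝ x y ⊆ Metric.sphere (0 : E) 1 := by
    intro w hw
    have h1 : ‖w‖ ≤ 1 := by
      have := (convex_closedBall (0 : E) 1).segment_subset (by simp [hx1]) hy hw
      simpa using this
    have h2 : g₀ w = 1 := by
      obtain ⟨s, t, -, -, hst, rfl⟩ := hw
      simp [hg₀J.2, hJy g₀ hg₀J, hst]
    have h3 := g₀.le_opNorm w
    rw [hg₀, one_mul, h2] at h3
    simpa using h1.antisymm (by simpa using h3)
  by_contra hne
  have hy1 : ‖y‖ = 1 := by simpa using hseg (right_mem_segment ℝ x y)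
  refine hns y hy1 hne hseg ⟨hx1, ?_⟩
  set S := Submodule.span ℝ ({x, y} : Set E) with hS
  -- A norming functional on the span extends to one on the whole space, so it is `1` at `x` and `y`.
  have key : ∀ f : StrongDual ℝ S, ‖f‖ = 1 →
      f ⟨x, Submodule.subset_span (Set.mem_insert x {y})⟩ = 1 →
      ∀ w : S, f w = g₀ w := by
    intro f hf hfx w
    obtain ⟨g, hgext, hgn⟩ := exists_extension_norm_eq S f
    have hgJ : g ∈ J := ⟨hgn.trans hf, by rw [← hfx, ← hgext]⟩
    rw [← hgext]
    have hw := w.2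
    obtain ⟨s, t, h⟩ := Submodule.mem_span_pair.1 hw
    rw [← h]
    simp [hgJ.2, hJy g hgJ, hg₀J.2, hJy g₀ hg₀J]
  have hxS : (⟨x, Submodule.subset_span (Set.mem_insert x {y})⟩ : S) ≠ 0 := fun h =>
    hx0 (congrArg Subtype.val h)
  obtain ⟨f, hf, hfx⟩ := exists_dual_vector ℝ _ (norm_ne_zero_iff.2 hxS)
  have hfx' : f ⟨x, Submodule.subset_span (Set.mem_insert x {y})⟩ = 1 := by
    rw [hfx]; simp [hx1]
  refine ⟨f, ⟨hf, hfx'⟩, fun f' hf' => ?_⟩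
  ext w
  rw [key f' hf'.1 hf'.2, key f hf hfx']

/-! ### Operator norm and trace norm of special matrices -/

theorem operatorNorm_le_of_conjTranspose_mul_self {n : ℕ} {u : Matrix (Fin n) (Fin n) ℂ} {c : ℝ}
    (hc : 0 ≤ c) (hu : uᴴ * u = ((c ^ 2 : ℝ) : ℂ) • 1) : operatorNorm u ≤ c := by
  have h : star (toEuclideanCLM (n := Fin n) (𝕜 := ℂ) u) * toEuclideanCLM (n := Fin n) (𝕜 := ℂ) u =
      ((c ^ 2 : ℝ) : ℂ) • 1 := by
    rw [← map_star, ← map_mul, star_eq_conjTranspose, hu, map_smul, map_one]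
  have h2 := CStarRing.norm_star_mul_self (x := toEuclideanCLM (n := Fin n) (𝕜 := ℂ) u)
  have h3 : ‖(1 : EuclideanSpace ℂ (Fin n) →L[ℂ] EuclideanSpace ℂ (Fin n))‖ ≤ 1 :=
    ContinuousLinearMap.norm_id_le
  rw [h, norm_smul, Complex.norm_real, Real.norm_of_nonneg (sq_nonneg c)] at h2
  have h4 : operatorNorm u * operatorNorm u ≤ c ^ 2 := by
    rw [operatorNorm, ← h2]
    exact mul_le_of_le_one_right (sq_nonneg c) h3
  nlinarith [operatorNorm_nonneg u]

theorem operatorNorm_conjTranspose {n : ℕ} (u : Matrix (Fin n) (Fin n) ℂ) :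
    operatorNorm uᴴ = operatorNorm u := by
  rw [operatorNorm, ← star_eq_conjTranspose, map_star]
  exact norm_star (toEuclideanCLM (n := Fin n) (𝕜 := ℂ) u)

/-- The singular values of `b` and `bᴴ` agree because `bᴴ * b` and `b * bᴴ` have the same
characteristic polynomial. -/
theorem traceNorm_conjTranspose {n : ℕ} (b : Matrix (Fin n) (Fin n) ℂ) :
    traceNorm bᴴ = traceNorm b := by
  have key : ∀ b : Matrix (Fin n) (Fin n) ℂ, traceNorm b =
      ((bᴴ * b).charpoly.roots.map fun z : ℂ => √z.re).sum := by
    intro b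
    rw [(isHermitian_conjTranspose_mul_self b).roots_charpoly_eq_eigenvalues, Multiset.map_map]
    simp [traceNorm, Finset.sum]
  rw [key, key, conjTranspose_conjTranspose, charpoly_mul_comm]

/-- A rank-one matrix has only one non-zero singular value, which is its Frobenius norm. -/
theorem traceNorm_vecMulVec_star {n : ℕ} {g : Fin n → ℂ} {d : ℝ} (hd : star g ⬝ᵥ g = d) :
    traceNorm (vecMulVec g (star g)) ≤ d := by
  set b := vecMulVec g (star g) with hb
  have hd0 : 0 ≤ d := by
    have := dotProduct_star_self_nonneg g
    rw [hd] at this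
    exact_mod_cast this
  have hH := isHermitian_conjTranspose_mul_self b
  have hrank : (bᴴ * b).rank ≤ 1 := (rank_mul_le_right _ _).trans (rank_vecMulVec_le _ _)
  rw [hH.rank_eq_card_non_zero_eigs, Fintype.card_le_one_iff_subsingleton] at hrank
  have htr : (bᴴ * b).trace = ((d ^ 2 : ℝ) : ℂ) := by
    rw [hb, conjTranspose_vecMulVec, star_star, vecMulVec_mul_vecMulVec, hd, vecMulVec_smul,
      trace_smul, trace_vecMulVec, dotProduct_comm, hd]
    simp [sq]
  have hsum : ∑ i, hH.eigenvalues i = d ^ 2 := by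
    have h := hH.trace_eq_sum_eigenvalues
    rw [htr] at h
    apply Complex.ofReal_injective
    rw [h]
    simp
  rw [traceNorm]
  by_cases h0 : ∀ i, hH.eigenvalues i = 0
  · simp only [h0, Real.sqrt_zero, Finset.sum_const_zero, hd0]
  · push Not at h0
    obtain ⟨i, hi⟩ := h0
    have hz : ∀ j, j ≠ i → hH.eigenvalues j = 0 := by
      intro j hj
      by_contra hj0
      exact hj (congrArg Subtype.val (hrank.elim ⟨j, hj0⟩ ⟨i, hi⟩))
    rw [Finset.sum_eq_single i (fun j _ hj => hz j hj) (by simp)] at hsum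
    rw [Finset.sum_eq_single i (fun j _ hj => by rw [hz j hj, Real.sqrt_zero]) (by simp), hsum,
      Real.sqrt_sq hd0]

/-! ### Bounds for the norms `π` and `α` -/

theorem projectiveNorm_kronecker_le {n : ℕ} (x y : Matrix (Fin n) (Fin n) ℂ) :
    projectiveNorm (x ⊗ₖ y) ≤ operatorNorm x * traceNorm y := by
  refine csInf_le ⟨0, ?_⟩ ⟨1, fun _ => x, fun _ => y, by simp, by simp⟩
  rintro _ ⟨m, x, y, -, rfl⟩
  exact Finset.sum_nonneg fun i _ => mul_nonneg (operatorNorm_nonneg _) (traceNorm_nonneg _)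

theorem norm_trace_mul_kronecker_le {n : ℕ} {ρ : Matrix (Fin n × Fin n) (Fin n × Fin n) ℂ}
    (hρ : alphaNorm ρ ≤ 1) (x y : Matrix (Fin n) (Fin n) ℂ) :
    ‖(ρ * x ⊗ₖ y).trace‖ ≤ operatorNorm x * traceNorm y :=
  (norm_trace_mul_le_alphaNorm _ _).trans <|
    (mul_le_of_le_one_left (projectiveNorm_nonneg _) hρ).trans (projectiveNorm_kronecker_le x y)

theorem projectiveNorm_conjTranspose {n : ℕ} (a : Matrix (Fin n × Fin n) (Fin n × Fin n) ℂ) :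
    projectiveNorm aᴴ = projectiveNorm a := by
  have key : ∀ a : Matrix (Fin n × Fin n) (Fin n × Fin n) ℂ,
      projectiveCosts a ⊆ projectiveCosts aᴴ := by
    rintro a _ ⟨m, x, y, rfl, rfl⟩
    refine ⟨m, fun i => (x i)ᴴ, fun i => (y i)ᴴ, ?_, ?_⟩
    · simp [conjTranspose_sum, conjTranspose_kronecker]
    · simp [operatorNorm_conjTranspose, traceNorm_conjTranspose]
  have h := key aᴴ
  rw [conjTranspose_conjTranspose] at h
  rw [projectiveNorm, h.antisymm (key a), projectiveNorm]

theorem alphaNorm_conjTranspose_le {n : ℕ} (ρ : Matrix (Fin n × Fin n) (Fin n × Fin n) ℂ) :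
    alphaNorm ρᴴ ≤ alphaNorm ρ := by
  refine Real.iSup_le (fun a => ?_) (alphaNorm_nonneg ρ)
  rw [div_le_iff₀ (projectiveNorm_pos a.2)]
  have h := norm_trace_mul_le_alphaNorm ρ a.1ᴴ
  rwa [projectiveNorm_conjTranspose, ← norm_star, ← trace_conjTranspose, conjTranspose_mul,
    conjTranspose_conjTranspose, trace_mul_comm] at h

theorem alphaNorm_le_sum {n : ℕ} (ρ : Matrix (Fin n × Fin n) (Fin n × Fin n) ℂ) :
    alphaNorm ρ ≤ ∑ p, ∑ q, ‖ρ p q‖ := by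
  refine Real.iSup_le (fun a => ?_) (by positivity)
  exact (div_le_iff₀ (projectiveNorm_pos a.2)).2 (norm_trace_mul_le ρ a.1)

/-! ### Product vectors and the partial trace -/

/-- The product vector `f ⊗ g`. -/
def tensorVec {n : ℕ} (f g : Fin n → ℂ) : Fin n × Fin n → ℂ := fun p => f p.1 * g p.2

theorem trace_mul_kronecker_vecMulVec {n : ℕ} (ρ : Matrix (Fin n × Fin n) (Fin n × Fin n) ℂ)
    (f g : Fin n → ℂ) :
    (ρ * vecMulVec f (star f) ⊗ₖ vecMulVec g (star g)).trace =
      star (tensorVec f g) ⬝ᵥ (ρ *ᵥ tensorVec f g) := by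
  have h : vecMulVec f (star f) ⊗ₖ vecMulVec g (star g) =
      vecMulVec (tensorVec f g) (star (tensorVec f g)) := by
    ext p q
    simp [vecMulVec_apply, tensorVec]
    ring
  rw [h, mul_vecMulVec, trace_vecMulVec, dotProduct_comm]

/-- The partial trace over the first tensor factor. -/
def partialTrace {n : ℕ} (ρ : Matrix (Fin n × Fin n) (Fin n × Fin n) ℂ) :
    Matrix (Fin n) (Fin n) ℂ :=
  of fun j l => ∑ i, ρ (i, j) (i, l)

theorem trace_partialTrace {n : ℕ} (ρ : Matrix (Fin n × Fin n) (Fin n × Fin n) ℂ) :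
    (partialTrace ρ).trace = ρ.trace := by
  simp only [Matrix.trace, diag_apply, partialTrace, of_apply, Fintype.sum_prod_type]
  exact Finset.sum_comm

theorem trace_mul_one_kronecker {n : ℕ} (ρ : Matrix (Fin n × Fin n) (Fin n × Fin n) ℂ)
    (g : Fin n → ℂ) :
    (ρ * (1 : Matrix (Fin n) (Fin n) ℂ) ⊗ₖ vecMulVec g (star g)).trace =
      star g ⬝ᵥ (partialTrace ρ *ᵥ g) := by
  have h : (ρ * (1 : Matrix (Fin n) (Fin n) ℂ) ⊗ₖ vecMulVec g (star g)).trace =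
      (partialTrace ρ * vecMulVec g (star g)).trace := by
    simp only [Matrix.trace, diag_apply, mul_apply, partialTrace, of_apply, Fintype.sum_prod_type,
      kroneckerMap_apply, one_apply, ite_mul, one_mul, zero_mul, mul_ite, mul_zero,
      Finset.sum_ite_irrel, Finset.sum_const_zero, Finset.sum_ite_eq', Finset.mem_univ, if_true,
      Finset.sum_mul]
    rw [Finset.sum_comm]
    exact Finset.sum_congr rfl fun j _ => Finset.sum_comm
  rw [h, mul_vecMulVec, trace_vecMulVec, dotProduct_comm]

theorem conjTranspose_partialTrace {n : ℕ} (ρ : Matrix (Fin n × Fin n) (Fin n × Fin n) ℂ) :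
    (partialTrace ρ)ᴴ = partialTrace ρᴴ := by
  ext j l
  simp [partialTrace]

/-! ### The basic inequality for contractions -/

/-- A rotation of one of two complex numbers gives equality in the triangle inequality. -/
theorem Complex.exists_norm_add_mul_eq (u v : ℂ) :
    ∃ z : ℂ, ‖z‖ = 1 ∧ ‖u + z * v‖ = ‖u‖ + ‖v‖ := by
  obtain ⟨a, ha, hau⟩ := RCLike.exists_norm_eq_mul_self u
  obtain ⟨b, hb, hbv⟩ := RCLike.exists_norm_eq_mul_self v
  have ha0 : a ≠ 0 := norm_ne_zero_iff.1 (by simp [ha])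
  refine ⟨a⁻¹ * b, by simp [ha, hb], ?_⟩
  have h : a * (u + a⁻¹ * b * v) = ((‖u‖ + ‖v‖ : ℝ) : ℂ) := by
    rw [Complex.ofReal_add, show (‖u‖ : ℂ) = a * u from hau, show (‖v‖ : ℂ) = b * v from hbv]
    field_simp
  rw [← one_mul ‖u + _‖, ← ha, ← norm_mul, h, Complex.norm_real,
    Real.norm_of_nonneg (by positivity)]

theorem norm_partialTrace_form_le {n : ℕ} {ρ : Matrix (Fin n × Fin n) (Fin n × Fin n) ℂ}
    (hρ : alphaNorm ρ ≤ 1) {g : Fin n → ℂ} {d : ℝ} (hd : star g ⬝ᵥ g = d) :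
    ‖star g ⬝ᵥ (partialTrace ρ *ᵥ g)‖ ≤ d := by
  rw [← trace_mul_one_kronecker]
  refine (norm_trace_mul_kronecker_le hρ _ _).trans ?_
  refine (mul_le_of_le_one_left (traceNorm_nonneg _) ?_).trans (traceNorm_vecMulVec_star hd)
  exact operatorNorm_le_of_conjTranspose_mul_self zero_le_one (by simp)

/-- The basic inequality for a contraction `ρ`. It is the bound `|Tr (ρ (u ⊗ g g*))| ≤ ‖f‖² ‖g‖²` for
the multiples `u = ‖f‖² + (z - 1) f f*` of unitaries, `|z| = 1`, with the most favourable `z`. -/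
theorem norm_form_sub_add_norm_form_le {n : ℕ} {ρ : Matrix (Fin n × Fin n) (Fin n × Fin n) ℂ}
    (hρ : alphaNorm ρ ≤ 1) {f g : Fin n → ℂ} {c d : ℝ} (hc : star f ⬝ᵥ f = c)
    (hd : star g ⬝ᵥ g = d) :
    ‖c * (star g ⬝ᵥ (partialTrace ρ *ᵥ g)) - star (tensorVec f g) ⬝ᵥ (ρ *ᵥ tensorVec f g)‖ +
      ‖star (tensorVec f g) ⬝ᵥ (ρ *ᵥ tensorVec f g)‖ ≤ c * d := by
  have hc0 : 0 ≤ c := by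
    have := dotProduct_star_self_nonneg f
    rw [hc] at this
    exact_mod_cast this
  obtain ⟨z, hz, hnorm⟩ := Complex.exists_norm_add_mul_eq
    (c * (star g ⬝ᵥ (partialTrace ρ *ᵥ g)) - star (tensorVec f g) ⬝ᵥ (ρ *ᵥ tensorVec f g))
    (star (tensorVec f g) ⬝ᵥ (ρ *ᵥ tensorVec f g))
  rw [← hnorm]
  set P := vecMulVec f (star f) with hP
  have hPH : Pᴴ = P := by rw [hP, conjTranspose_vecMulVec, star_star]
  have hPP : P * P = (c : ℂ) • P := by
    rw [hP, vecMulVec_mul_vecMulVec, hc, vecMulVec_smul]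
  have hzz : star z * z = 1 := by
    have := Complex.conj_mul' z
    rw [hz] at this
    simpa using this
  set u : Matrix (Fin n) (Fin n) ℂ := (c : ℂ) • 1 + (z - 1) • P with hu
  have huu : uᴴ * u = ((c ^ 2 : ℝ) : ℂ) • 1 := by
    have h1 : uᴴ = (c : ℂ) • 1 + (star z - 1) • P := by
      rw [hu, conjTranspose_add, conjTranspose_smul, conjTranspose_smul, hPH, conjTranspose_one]
      simp
    rw [h1, hu]
    simp only [add_mul, mul_add, smul_mul_smul_comm, one_mul, mul_one, hPP, smul_smul]
    have h2 : (star z - 1) * (z - 1) * c = -(c * (z - 1) + (star z - 1) * c) := by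
      linear_combination (c : ℂ) * hzz
    rw [h2, neg_smul, add_smul]
    push_cast
    rw [sq]
    abel
  have hform : c * (star g ⬝ᵥ (partialTrace ρ *ᵥ g)) -
      star (tensorVec f g) ⬝ᵥ (ρ *ᵥ tensorVec f g) +
      z * (star (tensorVec f g) ⬝ᵥ (ρ *ᵥ tensorVec f g)) =
      (ρ * u ⊗ₖ vecMulVec g (star g)).trace := by
    rw [hu, add_kronecker, smul_kronecker, smul_kronecker, mul_add, Matrix.mul_smul, Matrix.mul_smul,
      trace_add,
      trace_smul, trace_smul, trace_mul_one_kronecker, trace_mul_kronecker_vecMulVec]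
    simp only [smul_eq_mul]
    ring
  rw [hform]
  refine (norm_trace_mul_kronecker_le hρ _ _).trans ?_
  exact mul_le_mul (operatorNorm_le_of_conjTranspose_mul_self hc0 huu)
    (traceNorm_vecMulVec_star hd) (traceNorm_nonneg _) hc0

/-! ### Quadratic forms -/

theorem Matrix.PosSemidef.norm_apply_le_trace {n : ℕ} {D : Matrix (Fin n) (Fin n) ℂ}
    (hD : D.PosSemidef) (i j : Fin n) : ‖D i j‖ ≤ D.trace.re := by
  have hdiag : ∀ k, 0 ≤ (D k k).re := fun k => (Complex.le_def.1 (hD.diag_nonneg (i := k))).1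
  have htr : D.trace.re = ∑ k, (D k k).re := by simp [Matrix.trace]
  have hle : ∀ k, (D k k).re ≤ D.trace.re := fun k => by
    rw [htr]
    exact Finset.single_le_sum (f := fun k => (D k k).re) (fun k _ => hdiag k) (Finset.mem_univ k)
  obtain ⟨z, hz, hzD⟩ := RCLike.exists_norm_eq_mul_self (D i j)
  have hzz : star z * z = 1 := by
    have := Complex.conj_mul' z
    rw [hz] at this
    simpa using this
  have hDji : D j i = star (D i j) := (hD.isHermitian.apply j i).symm
  -- With this `z`, the quadratic form of `D` at `eᵢ - z eⱼ` is `Dᵢᵢ + Dⱼⱼ - 2 |Dᵢⱼ|`.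
  have h := hD.dotProduct_mulVec_nonneg (Pi.single i 1 - z • Pi.single j 1)
  have h2 : star (Pi.single i 1 - z • Pi.single j 1 : Fin n → ℂ) ⬝ᵥ
      (D *ᵥ (Pi.single i 1 - z • Pi.single j 1)) =
      D i i + D j j - (z * D i j + star (z * D i j)) := by
    have hstar : star (Pi.single i 1 - z • Pi.single j 1 : Fin n → ℂ) =
        Pi.single i 1 - star z • Pi.single j 1 := by
      simp [star_sub, star_smul, Pi.star_single]
    rw [hstar, mulVec_sub, mulVec_smul, sub_dotProduct, smul_dotProduct, dotProduct_sub,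
      dotProduct_sub, dotProduct_smul, dotProduct_smul]
    simp only [single_dotProduct, one_mul, mulVec_single_one, col_apply, hDji, smul_eq_mul,
      star_mul']
    linear_combination D j j * hzz
  rw [h2, ← show ((‖D i j‖ : ℝ) : ℂ) = z * D i j from hzD] at h
  have h3 := (Complex.le_def.1 h).1
  simp at h3
  linarith [hle i, hle j]

theorem eq_zero_of_forall_star_dotProduct_mulVec_eq_zero {n : ℕ} {M : Matrix (Fin n) (Fin n) ℂ}
    (h : ∀ f : Fin n → ℂ, star f ⬝ᵥ (M *ᵥ f) = 0) : M = 0 := by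
  have : Matrix.toEuclideanLin M = 0 := by
    rw [← inner_map_self_eq_zero]
    intro x
    rw [← inner_conj_symm, EuclideanSpace.inner_eq_star_dotProduct, dotProduct_comm]
    simp [h]
  simpa using this

/-- Polarization in both tensor factors: the values on product vectors determine a matrix. -/
theorem eq_zero_of_forall_tensorVec_eq_zero {n : ℕ}
    {ρ : Matrix (Fin n × Fin n) (Fin n × Fin n) ℂ}
    (h : ∀ f g, star (tensorVec f g) ⬝ᵥ (ρ *ᵥ tensorVec f g) = 0) : ρ = 0 := by
  have h1 : ∀ i k, (of fun j l => ρ (i, j) (k, l) : Matrix (Fin n) (Fin n) ℂ) = 0 := by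
    intro i k
    refine eq_zero_of_forall_star_dotProduct_mulVec_eq_zero fun g => ?_
    have h2 : (of fun i k => star g ⬝ᵥ ((of fun j l => ρ (i, j) (k, l)) *ᵥ g) :
        Matrix (Fin n) (Fin n) ℂ) = 0 := by
      refine eq_zero_of_forall_star_dotProduct_mulVec_eq_zero fun f => ?_
      rw [← h f g]
      simp only [dotProduct, mulVec, tensorVec, of_apply, Pi.star_apply, Fintype.sum_prod_type,
        star_mul', Finset.mul_sum, Finset.sum_mul]
      refine Finset.sum_congr rfl fun i _ => ?_
      rw [Finset.sum_comm]
      refine Finset.sum_congr rfl fun j _ => Finset.sum_congr rfl fun k _ =>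
        Finset.sum_congr rfl fun l _ => by ring
    exact congrFun (congrFun h2 i) k
  ext ⟨i, j⟩ ⟨k, l⟩
  exact congrFun (congrFun (h1 i k) j) l

theorem star_dotProduct_conjTranspose_mulVec {m : Type*} [Fintype m] (M : Matrix m m ℂ)
    (f : m → ℂ) : star f ⬝ᵥ (Mᴴ *ᵥ f) = star (star f ⬝ᵥ (M *ᵥ f)) := by
  rw [star_dotProduct, star_mulVec, ← dotProduct_mulVec]
  simp

/-! ### Block positive elements -/

namespace AlphaSpace

variable {n : ℕ}

theorem blockPositive_iff (ρ : AlphaSpace n) :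
    BlockPositive ρ ↔ ∀ f g : Fin n → ℂ,
      0 ≤ star (tensorVec f g) ⬝ᵥ (toMatrix ρ *ᵥ tensorVec f g) :=
  Iff.rfl

theorem toMatrix_real_smul (c : ℝ) (ρ : AlphaSpace n) :
    toMatrix (c • ρ) = (c : ℂ) • toMatrix ρ := rfl

theorem BlockPositive.isHermitian {ρ : AlphaSpace n} (h : BlockPositive ρ) :
    (toMatrix ρ).IsHermitian := by
  rw [Matrix.IsHermitian, ← sub_eq_zero]
  refine eq_zero_of_forall_tensorVec_eq_zero fun f g => ?_
  have h1 := h f g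
  rw [sub_mulVec, dotProduct_sub, star_dotProduct_conjTranspose_mulVec]
  exact sub_eq_zero.2 (IsSelfAdjoint.of_nonneg h1).star_eq

theorem exists_real_star_dotProduct_self (f : Fin n → ℂ) : ∃ c : ℝ, star f ⬝ᵥ f = c := by
  have h := Complex.le_def.1 (dotProduct_star_self_nonneg f)
  exact ⟨(star f ⬝ᵥ f).re, Complex.ext rfl (by simpa using h.2.symm)⟩

/-- The map `x ↦ Tr₁ (ρ (x ⊗ 1))` of a hermitian contraction `ρ` sends `1` to a matrix `≤ 1`. -/
theorem posSemidef_one_sub_partialTrace {ρ : Matrix (Fin n × Fin n) (Fin n × Fin n) ℂ}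
    (hρ : alphaNorm ρ ≤ 1) (hH : ρ.IsHermitian) : (1 - partialTrace ρ).PosSemidef := by
  have hA : (partialTrace ρ).IsHermitian := by
    rw [Matrix.IsHermitian, conjTranspose_partialTrace, hH.eq]
  refine .of_dotProduct_mulVec_nonneg (isHermitian_one.sub hA) fun g => ?_
  obtain ⟨d, hd⟩ := exists_real_star_dotProduct_self g
  rw [sub_mulVec, one_mulVec, dotProduct_sub, hd, Complex.le_def]
  have := (Complex.re_le_norm _).trans (norm_partialTrace_form_le hρ hd)
  exact ⟨by simpa using this, by simpa using hA.im_star_dotProduct_mulVec_self g⟩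

theorem star_tensorVec_dotProduct_one_kronecker (D : Matrix (Fin n) (Fin n) ℂ) (f g : Fin n → ℂ) :
    star (tensorVec f g) ⬝ᵥ (((1 : Matrix (Fin n) (Fin n) ℂ) ⊗ₖ D) *ᵥ tensorVec f g) =
      (star f ⬝ᵥ f) * (star g ⬝ᵥ (D *ᵥ g)) := by
  rw [← trace_mul_kronecker_vecMulVec, ← mul_kronecker_mul, trace_kronecker, one_mul,
    trace_vecMulVec, mul_vecMulVec, trace_vecMulVec, dotProduct_comm f, dotProduct_comm _ (star g)]

/-- A hermitian contraction becomes block positive after adding a correction that is linear in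
`1 - partialTrace ρ`. -/
theorem blockPositive_add_correction {ρ : AlphaSpace n} (hρ : ‖ρ‖ ≤ 1)
    (hH : (toMatrix ρ).IsHermitian) :
    BlockPositive (ρ + (1 / 2 : ℝ) • toMatrix.symm
      ((1 : Matrix (Fin n) (Fin n) ℂ) ⊗ₖ (1 - partialTrace (toMatrix ρ)))) := by
  rw [blockPositive_iff]
  intro f g
  obtain ⟨c, hc⟩ := exists_real_star_dotProduct_self f
  obtain ⟨d, hd⟩ := exists_real_star_dotProduct_self g
  have hA : (partialTrace (toMatrix ρ)).IsHermitian := by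
    rw [Matrix.IsHermitian, conjTranspose_partialTrace, hH.eq]
  have key := norm_form_sub_add_norm_form_le hρ hc hd
  have hs := hH.im_star_dotProduct_mulVec_self (tensorVec f g)
  have ha := hA.im_star_dotProduct_mulVec_self g
  rw [map_add, toMatrix_real_smul, LinearEquiv.apply_symm_apply, add_mulVec, dotProduct_add,
    smul_mulVec, dotProduct_smul, star_tensorVec_dotProduct_one_kronecker, sub_mulVec, one_mulVec,
    dotProduct_sub, hc, hd]
  set s := star (tensorVec f g) ⬝ᵥ (toMatrix ρ *ᵥ tensorVec f g)
  set a := star g ⬝ᵥ (partialTrace (toMatrix ρ) *ᵥ g)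
  have h1 := Complex.re_le_norm (c * a - s)
  have h2 := (neg_le_abs _).trans (Complex.abs_re_le_norm s)
  rw [Complex.sub_re, Complex.re_ofReal_mul] at h1
  rw [Complex.le_def]
  constructor
  · simp
    linarith
  · simp only [RCLike.im_to_complex] at hs ha
    simp [hs, ha]

/-- A unital contraction between matrix algebras is a positive map; unitality enters through the real
part of the quadratic form of `partialTrace ρ`. -/
theorem blockPositive_of_re_partialTrace_form {ρ : AlphaSpace n} (hρ : ‖ρ‖ ≤ 1)
    (hpt : ∀ g : Fin n → ℂ, (star g ⬝ᵥ (partialTrace (toMatrix ρ) *ᵥ g)).re =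
      (star g ⬝ᵥ g).re) : BlockPositive ρ := by
  rw [blockPositive_iff]
  intro f g
  obtain ⟨c, hc⟩ := exists_real_star_dotProduct_self f
  obtain ⟨d, hd⟩ := exists_real_star_dotProduct_self g
  have key := norm_form_sub_add_norm_form_le hρ hc hd
  have ha := norm_partialTrace_form_le hρ hd
  have hg := hpt g
  set s := star (tensorVec f g) ⬝ᵥ (toMatrix ρ *ᵥ tensorVec f g)
  set a := star g ⬝ᵥ (partialTrace (toMatrix ρ) *ᵥ g)
  rw [hd, Complex.ofReal_re] at hg
  have had : a = d := by
    have := Complex.nonneg_iff.1 (Complex.re_eq_norm.1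
      ((Complex.re_le_norm a).antisymm (hg ▸ ha)))
    exact Complex.ext hg (by simpa using this.2.symm)
  have h1 := Complex.re_le_norm (c * a - s)
  rw [had] at h1 key
  rw [Complex.sub_re, Complex.re_ofReal_mul, Complex.ofReal_re] at h1
  exact Complex.re_eq_norm.1 ((Complex.re_le_norm s).antisymm (by linarith))

/-! ### The hermitian part -/

/-- The hermitian part `(ρ + ρ*) / 2`, as a real linear map. -/
noncomputable def hermitianPartMap (n : ℕ) : AlphaSpace n →ₗ[ℝ] AlphaSpace n where
  toFun ρ := (1 / 2 : ℝ) • (ρ + toMatrix.symm (toMatrix ρ)ᴴ)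
  map_add' ρ σ := by
    rw [map_add, conjTranspose_add, map_add, ← smul_add]
    congr 1
    abel
  map_smul' c ρ := by
    have : (toMatrix (c • ρ))ᴴ = (c : ℂ) • (toMatrix ρ)ᴴ := by
      rw [toMatrix_real_smul, conjTranspose_smul]
      simp
    rw [this, map_smul, RingHom.id_apply, smul_comm c]
    congr 1
    exact (smul_add c _ _).symm

theorem toMatrix_hermitianPartMap (ρ : AlphaSpace n) :
    toMatrix (hermitianPartMap n ρ) = (1 / 2 : ℂ) • (toMatrix ρ + (toMatrix ρ)ᴴ) := by
  change toMatrix ((1 / 2 : ℝ) • (ρ + toMatrix.symm (toMatrix ρ)ᴴ)) = _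
  rw [toMatrix_real_smul, map_add, LinearEquiv.apply_symm_apply]
  simp

theorem isHermitian_hermitianPartMap (ρ : AlphaSpace n) :
    (toMatrix (hermitianPartMap n ρ)).IsHermitian := by
  rw [toMatrix_hermitianPartMap, Matrix.IsHermitian, conjTranspose_smul, conjTranspose_add,
    conjTranspose_conjTranspose, add_comm]
  simp

theorem hermitianPartMap_of_isHermitian {ρ : AlphaSpace n} (h : (toMatrix ρ).IsHermitian) :
    hermitianPartMap n ρ = ρ := by
  apply toMatrix.injective
  rw [toMatrix_hermitianPartMap, h.eq, ← two_smul ℂ (toMatrix ρ), smul_smul]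
  norm_num

theorem norm_hermitianPartMap_le (ρ : AlphaSpace n) : ‖hermitianPartMap n ρ‖ ≤ ‖ρ‖ := by
  change ‖(1 / 2 : ℝ) • (ρ + toMatrix.symm (toMatrix ρ)ᴴ)‖ ≤ ‖ρ‖
  have h : ‖toMatrix.symm (toMatrix ρ)ᴴ‖ ≤ ‖ρ‖ := by
    rw [norm_def, norm_def, LinearEquiv.apply_symm_apply]
    exact alphaNorm_conjTranspose_le _
  rw [norm_smul, Real.norm_of_nonneg (by norm_num)]
  linarith [norm_add_le ρ (toMatrix.symm (toMatrix ρ)ᴴ)]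

/-! ### Contractions of maximal trace -/

instance : FiniteDimensional ℂ (AlphaSpace n) := LinearEquiv.finiteDimensional toMatrix.symm

instance : FiniteDimensional ℝ (AlphaSpace n) := FiniteDimensional.complexToReal _

theorem norm_one_kronecker_le {D : Matrix (Fin n) (Fin n) ℂ} (hD : D.PosSemidef) :
    ‖toMatrix.symm ((1 : Matrix (Fin n) (Fin n) ℂ) ⊗ₖ D)‖ ≤ (n : ℝ) ^ 4 * D.trace.re := by
  rw [norm_def, LinearEquiv.apply_symm_apply]
  refine (alphaNorm_le_sum _).trans ?_
  have h : ∀ p q : Fin n × Fin n,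
      ‖((1 : Matrix (Fin n) (Fin n) ℂ) ⊗ₖ D) p q‖ ≤ D.trace.re := by
    intro p q
    refine le_trans ?_ (hD.norm_apply_le_trace p.2 q.2)
    rw [kroneckerMap_apply, norm_mul]
    refine mul_le_of_le_one_left (norm_nonneg _) ?_
    rw [one_apply]
    split_ifs <;> simp
  refine (Finset.sum_le_sum fun p _ => Finset.sum_le_sum fun q _ => h p q).trans_eq ?_
  simp
  ring

theorem trace_one_sub_partialTrace_hermitianPartMap (ρ : AlphaSpace n) :
    (1 - partialTrace (toMatrix (hermitianPartMap n ρ))).trace.re = n - (toMatrix ρ).trace.re := by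
  rw [trace_sub, trace_one, trace_partialTrace, toMatrix_hermitianPartMap, trace_smul, trace_add,
    trace_conjTranspose]
  simp
  ring

/-- A contraction whose trace has the maximal real part `n` is unital, hence block positive. -/
theorem blockPositive_of_re_trace_eq {ρ : AlphaSpace n} (hρ : ‖ρ‖ ≤ 1)
    (htr : (toMatrix ρ).trace.re = n) : BlockPositive ρ := by
  have hD := posSemidef_one_sub_partialTrace ((norm_hermitianPartMap_le ρ).trans hρ)
    (isHermitian_hermitianPartMap ρ)
  have h0 : 1 - partialTrace (toMatrix (hermitianPartMap n ρ)) = 0 := by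
    rw [← hD.trace_eq_zero_iff]
    have h1 := Complex.nonneg_iff.1 hD.trace_nonneg
    refine Complex.ext ?_ h1.2.symm
    rw [trace_one_sub_partialTrace_hermitianPartMap, htr, sub_self, Complex.zero_re]
  refine blockPositive_of_re_partialTrace_form hρ fun g => ?_
  have h2 : partialTrace (toMatrix (hermitianPartMap n ρ)) =
      (1 / 2 : ℂ) • (partialTrace (toMatrix ρ) + (partialTrace (toMatrix ρ))ᴴ) := by
    rw [toMatrix_hermitianPartMap, conjTranspose_partialTrace]
    ext i j
    simp [partialTrace, Finset.sum_add_distrib, ← Finset.mul_sum]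
  have h3 : star g ⬝ᵥ g = star g ⬝ᵥ (partialTrace (toMatrix (hermitianPartMap n ρ)) *ᵥ g) := by
    rw [← sub_eq_zero.1 h0, one_mulVec]
  rw [h3, h2, smul_mulVec, dotProduct_smul, add_mulVec, dotProduct_add,
    star_dotProduct_conjTranspose_mulVec]
  simp
  ring

/-! ### Exposed points -/

/-- A functional `φ` exposing `σ` in the block positive part of the ball is turned into one exposing
`σ` in the whole ball: the sum of `φ` of the hermitian part and a large multiple `K` of the real
part of the trace. -/
theorem exposedPoint_unitBall_of_trace_eq {X : Submodule ℝ (AlphaSpace n)}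
    (hX : hermitianPart n ≤ X) {σ : X} (hσ : σ ∈ (positiveUnitBall X).exposedPoints ℝ)
    (htr : (toMatrix (σ : AlphaSpace n)).trace = (n : ℂ)) :
    σ ∈ (unitBall X).exposedPoints ℝ := by
  obtain ⟨⟨hσ1, hσH, hσB⟩, φ, hφ⟩ := hσ
  have hσ0 : 0 ≤ φ σ := by
    have := (hφ 0 ⟨by simp, by simp, by simp [blockPositive_iff]⟩).1
    simpa using this
  -- `H` is the hermitian part, `τ` the real part of the trace.
  let H : X →ₗ[ℝ] X := (hermitianPartMap n ∘ₗ X.subtype).codRestrict X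
    fun ρ => hX (isHermitian_hermitianPartMap _)
  let τ : X →ₗ[ℝ] ℝ := Complex.reLm ∘ₗ (traceLinearMap (Fin n × Fin n) ℝ ℂ) ∘ₗ
    ((toMatrix (n := n)).toLinearMap.restrictScalars ℝ) ∘ₗ X.subtype
  have hτ : ∀ ρ : X, τ ρ = (toMatrix (ρ : AlphaSpace n)).trace.re := fun _ => rfl
  set C : ℝ := (n : ℝ) ^ 4 / 2 with hC
  have hC0 : 0 ≤ C := by positivity
  set K : ℝ := C * (φ σ + ‖φ‖) + 1 with hK
  -- `K` is chosen so that losing `n - τ ρ` in the trace outweighs the possible gain in `φ ∘ H`.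
  have hHσ : H σ = σ := Subtype.ext (hermitianPartMap_of_isHermitian hσH)
  have hτσ : τ σ = n := by rw [hτ, htr]; simp
  have hδ : ∀ ρ ∈ unitBall X, τ ρ ≤ n ∧ φ (H ρ) ≤ φ σ + C * (n - τ ρ) * (φ σ + ‖φ‖) := by
    intro ρ hρ
    have hHρ : ‖hermitianPartMap n (ρ : AlphaSpace n)‖ ≤ 1 := (norm_hermitianPartMap_le _).trans hρ
    have hherm := isHermitian_hermitianPartMap (ρ : AlphaSpace n)
    have hD := posSemidef_one_sub_partialTrace hHρ hherm
    have hcorr := norm_one_kronecker_le hD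
    have hpos := blockPositive_add_correction hHρ hherm
    have htrace := (Complex.nonneg_iff.1 hD.trace_nonneg).1
    rw [trace_one_sub_partialTrace_hermitianPartMap, ← hτ] at hcorr htrace
    set κ : AlphaSpace n := (1 / 2 : ℝ) • toMatrix.symm ((1 : Matrix (Fin n) (Fin n) ℂ) ⊗ₖ
      (1 - partialTrace (toMatrix (hermitianPartMap n (ρ : AlphaSpace n))))) with hκ
    have hκn : ‖κ‖ ≤ C * (n - τ ρ) := by
      rw [hκ, norm_smul, Real.norm_of_nonneg (by norm_num), hC]
      linarith
    have hsum : hermitianPartMap n (ρ : AlphaSpace n) + κ ∈ X := hX hpos.isHermitian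
    have hκX : κ ∈ X := by
      have := X.sub_mem hsum (H ρ).2
      have h2 : hermitianPartMap n (ρ : AlphaSpace n) + κ - (H ρ : AlphaSpace n) = κ :=
        add_sub_cancel_left _ _
      rwa [h2] at this
    set c : ℝ := 1 + C * (n - τ ρ) with hc
    have hc0 : 0 < c := by positivity
    have hnorm : ‖hermitianPartMap n (ρ : AlphaSpace n) + κ‖ ≤ c :=
      (norm_add_le _ _).trans (add_le_add hHρ hκn)
    -- Normalizing the block positive element `H ρ + κ` allows to compare it with `σ`.
    have hmem : c⁻¹ • (⟨_, hsum⟩ : X) ∈ positiveUnitBall X := by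
      have hB : BlockPositive (c⁻¹ • (hermitianPartMap n (ρ : AlphaSpace n) + κ)) := by
        rw [blockPositive_iff] at hpos ⊢
        intro f g
        rw [toMatrix_real_smul, smul_mulVec, dotProduct_smul]
        exact mul_nonneg (by exact_mod_cast (inv_pos.2 hc0).le) (hpos f g)
      refine ⟨?_, hB.isHermitian, hB⟩
      rw [norm_smul, norm_inv, Real.norm_of_nonneg hc0.le, inv_mul_le_iff₀ hc0, mul_one]
      exact hnorm
    have h1 := (hφ _ hmem).1
    rw [map_smul, smul_eq_mul, inv_mul_le_iff₀ hc0] at h1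
    have h2 : (⟨_, hsum⟩ : X) = H ρ + ⟨κ, hκX⟩ := rfl
    rw [h2, map_add] at h1
    have h3 : -φ ⟨κ, hκX⟩ ≤ ‖φ‖ * (C * (n - τ ρ)) :=
      (neg_le_abs _).trans ((φ.le_opNorm _).trans (by gcongr; exact hκn))
    refine ⟨by linarith, ?_⟩
    rw [hc] at h1
    linarith
  refine ⟨hσ1, LinearMap.toContinuousLinearMap (φ.toLinearMap ∘ₗ H + K • τ), fun ρ hρ => ?_⟩
  have hval : ∀ ρ : X, LinearMap.toContinuousLinearMap (φ.toLinearMap ∘ₗ H + K • τ) ρ =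
      φ (H ρ) + K * τ ρ := fun _ => rfl
  rw [hval, hval, hHσ, hτσ]
  obtain ⟨h1, h2⟩ := hδ ρ hρ
  have h3 : φ (H ρ) + K * τ ρ ≤ φ σ + K * n - (n - τ ρ) := by
    rw [hK]; linarith
  refine ⟨by linarith, fun hge => ?_⟩
  have hτn : τ ρ = n := by linarith
  have hB : BlockPositive (ρ : AlphaSpace n) := blockPositive_of_re_trace_eq hρ (by rw [← hτ, hτn])
  refine (hφ ρ ⟨hρ, hB.isHermitian, hB⟩).2 ?_
  have hHρ : H ρ = ρ := Subtype.ext (hermitianPartMap_of_isHermitian hB.isHermitian)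
  rw [hHρ, hτn] at hge
  linarith

end AlphaSpace

theorem mainTheorem1 (n : ℕ) (X : Submodule ℝ (AlphaSpace n))
    (hX : X = ⊤ ∨ X = AlphaSpace.hermitianPart n) :
    (∀ σ ∈ (AlphaSpace.positiveUnitBall X).exposedPoints ℝ,
      (AlphaSpace.toMatrix (σ : AlphaSpace n)).trace = (n : ℂ) →
        σ ∈ (AlphaSpace.unitBall X).exposedPoints ℝ) ∧
    (∀ ρ ∈ AlphaSpace.unitBall X,
      AlphaSpace.BlockPositive (ρ : AlphaSpace n) → IsStronglyNonSmoothPoint ρ →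
        ¬ IsRotundPoint ρ → ρ ∈ (AlphaSpace.positiveUnitBall X).exposedPoints ℝ) := by
  have hle : AlphaSpace.hermitianPart n ≤ X := by
    rcases hX with rfl | rfl
    exacts [le_top, le_rfl]
  refine ⟨fun σ hσ htr => AlphaSpace.exposedPoint_unitBall_of_trace_eq hle hσ htr,
    fun ρ hρ hB hns _ => ?_⟩
  obtain ⟨-, l, hl⟩ := hns.mem_exposedPoints_closedBall
  exact ⟨⟨hρ, hB.isHermitian, hB⟩, l, fun y hy => hl y (by simpa using hy.1)⟩
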